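/- **Definitions.** For a set $S$ let $\beta S$ be the set of ultrafilters on $S$. An *ultraposet* is a poset $P$ with, for every set $S$, a pairing $\langle -,-\rangle : P^S\times\beta S\to P$, monotone in $f\in P^S$, such that, writing $\delta_s$ for the principal ultrafilter at $s$, $i_*\nu$ for the pushforward of $\nu$ along $i$, and, for $\mu:T\to\beta S$ and $\nu\in\beta T$, $\langle\mu,\nu\rangle=\{A\subseteq S : \{t : A\in\mu_t\}\in\nu\}$: (unity) $\langle f,\delta_s\rangle=f(s)$; (lax associativity) $\langle f,\langle\mu,\nu\rangle\rangle\le\langle t\mapsto\langle f,\mu_t\rangle,\nu\rangle$; (locality) $\langle f,i_*\nu\rangle=\langle f\circ i,\nu\rangle$ for injective $i$. An *ultrafunctor* is a monotone map $\varphi$ with $\varphi\langle f,\mu\rangle=\langle\varphi f,\mu\rangle$ for all $f,\mu$. An *ultraset* is an ultraposet whose order is equality. A subset $K\subseteq P$ is *closed* if $f^{-1}(K)\in\mu$ implies $\langle f,\mu\rangle\in K$ for all $S$, $f:S\to P$, $\mu\in\beta S$; the closed sets are those of a topology on $P$, and ultrafunctors are continuous for it. $P$ is *zero-dimensional* if whenever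 $p\not\le q$ there is a closed down-set $K$ whose complement is a closed up-set, with $q\in K$ and $p\notin K$. For a distributive lattice $D$ with $0,1$, $\mathrm{Mod}(D)$ is the poset of $\{0,1\}$-preserving lattice homomorphisms $D\to\mathbf 2=\{0<1\}$ with the pointwise order; it is an ultraposet with $\langle f,\mu\rangle(p)=\bigvee_{A\in\mu}\bigwedge_{s\in A}f(s)(p)$, and $\mathrm{Mod}$ is a contravariant functor to ultraposets and ultrafunctors, acting on morphisms by precomposition. A *Stone space* is a totally disconnected compact Hausdorff space. An *isomorphism of categories* is a functor bijective on objects and on morphisms. **Corollary (Stone duality).** 1. For every distributive lattice $D$ with $0,1$, the order of $\mathrm{Mod}(D)$ is discrete (that is, equality) if and only if $D$ is Boolean (every element has a complement). 2. For every ultraset $X$, the topology of closed sets is compact Hausdorff, and $\langle f,\mu\rangle$ is a limit of $f$ along $\mu$ for all $f:S\to X$, $\mu\in\beta S$. Sending $X$ to this space and each ultrafunctor to its underlying map is an isomorphism from the category of ultrasets to the category of compact Hausdorff spaces. 3. An ultraset is zero-dimensional if and only if this space is zero-dimensional (its clopen sets form a basis), if and only if this space is totally disconnected, i.e. a Stone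 space. The same functor restricts to an isomorphism $F$ from the category of zero-dimensional ultrasets to the category $\mathbf{Stone}$ of Stone spaces and continuous maps. 4. For every Boolean algebra $B$, $\mathrm{Mod}(B)$ is a zero-dimensional ultraset, and $\mathrm{Mod}$ restricts to an equivalence $M$ from $\mathbf{Bool}^{\mathrm{op}}$ to the category of zero-dimensional ultrasets and ultrafunctors. Consequently there is an equivalence of categories $\mathbf{Stone}\simeq\mathbf{Bool}^{\mathrm{op}}$, one half of which is $F\circ M:\mathbf{Bool}^{\mathrm{op}}\to\mathbf{Stone}$. -/

import Mathlib

open CategoryTheory Topology Filter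

universe u v w

noncomputable section

/-! ### Ultraposets and ultrafunctors -/

/-- An ultrastructure on a poset `P`: a monotone pairing `⟨f, μ⟩ ∈ P` for every set `S`, every family
`f : S → P` and every ultrafilter `μ` on `S`. The pairing of `f` with a family `μ : T → βS` is
the pointwise one `t ↦ ⟨f, μ t⟩`. Here `pure s` is the principal ultrafilter at `s`, `ν.bind μ` is
the ultrafilter `{A | {t | A ∈ μ t} ∈ ν}`, and `ν.map i` is the pushforward. -/
class Ultraposet (P : Type u) [PartialOrder P] : Type (u + 1) where
  pair : ∀ {S : Type u}, (S → P) → Ultrafilter S → P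
  pair_mono : ∀ {S : Type u} (f g : S → P) (μ : Ultrafilter S), f ≤ g → pair f μ ≤ pair g μ
  /-- Unity. -/
  pair_pure : ∀ {S : Type u} (f : S → P) (s : S), pair f (pure s) = f s
  /-- Lax associativity. -/
  pair_bind_le : ∀ {S T : Type u} (f : S → P) (μ : T → Ultrafilter S) (ν : Ultrafilter T),
    pair f (ν.bind μ) ≤ pair (fun t => pair f (μ t)) ν
  /-- Locality. -/
  pair_map : ∀ {S W : Type u} (f : S → P) (i : W → S) (ν : Ultrafilter W),
    Function.Injective i → pair f (ν.map i) = pair (f ∘ i) ν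

/-- Ultrafunctors: monotone maps that preserve the pairing. -/
@[ext]
structure UltraFunctor (P Q : Type u) [PartialOrder P] [PartialOrder Q] [Ultraposet P]
    [Ultraposet Q] where
  toFun : P → Q
  monotone' : Monotone toFun
  map_pair' : ∀ {S : Type u} (f : S → P) (μ : Ultrafilter S),
    toFun (Ultraposet.pair f μ) = Ultraposet.pair (toFun ∘ f) μ

/-- The category of ultraposets and ultrafunctors. -/
structure UltPos : Type (u + 1) where
  carrier : Type u
  [order : PartialOrder carrier]
  [str : Ultraposet carrier]

namespace UltPos

instance : CoeSort UltPos.{u} (Type u) := ⟨UltPos.carrier⟩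

attribute [instance] UltPos.order UltPos.str

instance : Category UltPos.{u} where
  Hom P Q := UltraFunctor P Q
  id P := ⟨id, monotone_id, fun _ _ => rfl⟩
  comp φ ψ := ⟨ψ.toFun ∘ φ.toFun, ψ.monotone'.comp φ.monotone', fun f μ => by
    simp only [Function.comp_apply, φ.map_pair', ψ.map_pair']; rfl⟩

end UltPos

/-! ### Closed sets and zero-dimensional ultraposets -/

section ClosedSets

variable (P : Type u) [PartialOrder P] [Ultraposet P]

/-- Closed subsets of an ultraposet. -/
def UltraClosed (K : Set P) : Prop :=
  ∀ (S : Type u) (f : S → P) (μ : Ultrafilter S), f ⁻¹' K ∈ μ → Ultraposet.pair f μ ∈ K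

/-- The topology on an ultraposet whose closed sets are those of `UltraClosed`. -/
@[reducible]
def ultraTopology : TopologicalSpace P :=
  TopologicalSpace.ofClosed {K | UltraClosed P K}
    (fun _ _ _ h => (Ultrafilter.empty_notMem h).elim)
    (fun A hA S f μ h => Set.mem_sInter.2 fun K hK =>
      hA hK S f μ (Filter.mem_of_superset h (Set.preimage_mono (Set.sInter_subset_of_mem hK))))
    (fun K hK L hL S f μ h => by
      rw [Set.preimage_union, Ultrafilter.union_mem_iff] at h
      exact h.imp (hK S f μ) (hL S f μ))

theorem isClosed_ultraTopology_iff (K : Set P) :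
    IsClosed[ultraTopology P] K ↔ UltraClosed P K := by
  rw [← @isOpen_compl_iff _ _ (ultraTopology P)]
  change UltraClosed P Kᶜᶜ ↔ _
  rw [compl_compl]

/-- `P` is zero-dimensional: whenever `p ≰ q`, there is a complementary pair of a closed downset
`K ∋ q` and a closed upset `Kᶜ ∋ p`. -/
def ZeroDimensionalUltraposet : Prop :=
  ∀ p q : P, ¬ p ≤ q → ∃ K : Set P, UltraClosed P K ∧ IsLowerSet K ∧
    UltraClosed P Kᶜ ∧ IsUpperSet Kᶜ ∧ p ∈ Kᶜ ∧ q ∈ K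

/-- The order on `P` is the equality relation. -/
def DiscreteOrder (P : Type u) [PartialOrder P] : Prop :=
  ∀ x y : P, x ≤ y → x = y

end ClosedSets

theorem UltraFunctor.continuous {P Q : Type u} [PartialOrder P] [PartialOrder Q] [Ultraposet P]
    [Ultraposet Q] (φ : UltraFunctor P Q) :
    @Continuous _ _ (ultraTopology P) (ultraTopology Q) φ.toFun := by
  let _ := ultraTopology P
  let _ := ultraTopology Q
  refine continuous_iff_isClosed.2 fun L hL => ?_
  rw [isClosed_ultraTopology_iff] at hL ⊢
  intro S f μ h
  rw [Set.mem_preimage, φ.map_pair']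
  exact hL S _ μ h

/-- The functor from ultraposets to topological spaces given by the topology of closed sets. -/
def closedSetsFunctor : UltPos.{u} ⥤ TopCat.{u} where
  obj P := @TopCat.of P (ultraTopology P)
  map {P Q} φ :=
    letI := ultraTopology P
    letI := ultraTopology Q
    TopCat.ofHom ⟨φ.toFun, φ.continuous⟩

/-- Ultrasets: ultraposets with discrete order. -/
def isUltraset : ObjectProperty UltPos.{u} := fun P => DiscreteOrder P

/-- Zero-dimensional ultrasets. -/
def isZeroDimUltraset : ObjectProperty UltPos.{u} := fun P =>
  DiscreteOrder P ∧ ZeroDimensionalUltraposet P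

/-- The category of ultrasets. -/
abbrev UltSet := isUltraset.{u}.FullSubcategory

/-- The category of zero-dimensional ultrasets. -/
abbrev ZeroDimUltSet := isZeroDimUltraset.{u}.FullSubcategory

/-! ### The ultraposet of models of a distributive lattice -/

/-- The canonical ultraproduct `⋁_{A ∈ μ} ⋀_{s ∈ A} f s` in a complete lattice. -/
def canonicalPair {L : Type v} [CompleteLattice L] {S : Type w} (f : S → L) (μ : Ultrafilter S) :
    L :=
  ⨆ A ∈ μ, ⨅ s ∈ A, f s

theorem canonicalPair_mono {L : Type v} [CompleteLattice L] {S : Type w} {f g : S → L}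
    (h : f ≤ g) (μ : Ultrafilter S) : canonicalPair f μ ≤ canonicalPair g μ :=
  iSup₂_mono fun _ _ => iInf₂_mono fun s _ => h s

theorem canonicalPair_bool_eq_true {S : Type w} (f : S → Bool) (μ : Ultrafilter S) :
    canonicalPair f μ = true ↔ {s | f s = true} ∈ μ := by
  have h1 : ∀ b : Bool, b = true ↔ (⊤ : Bool) ≤ b := by decide
  constructor
  · intro h
    by_contra hc
    have hle : canonicalPair f μ ≤ false := by
      refine iSup₂_le fun A hA => ?_
      have : ¬ A ⊆ {s | f s = true} := fun hs => hc (Filter.mem_of_superset hA hs)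
      obtain ⟨s, hs, hfs⟩ := Set.not_subset.1 this
      have hfs' : f s = false := by simpa using hfs
      exact hfs' ▸ iInf₂_le s hs
    rw [h] at hle
    exact absurd hle (by decide)
  · intro h
    rw [h1]
    refine le_trans ?_ (le_iSup₂_of_le {s | f s = true} h le_rfl)
    exact le_iInf₂ fun s hs => (h1 _).1 hs

section Models

variable (D : Type u) [DistribLattice D] [BoundedOrder D]

/-- The models of a (bounded) distributive lattice `D`: the lattice homomorphisms from `D` to
`2 = {0 < 1}`, preserving `⊥` and `⊤`, with the pointwise order. -/
def LatticeModel : Type u := BoundedLatticeHom D Bool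

variable {D}

instance : FunLike (LatticeModel D) D Bool :=
  inferInstanceAs (FunLike (BoundedLatticeHom D Bool) D Bool)

instance : BoundedLatticeHomClass (LatticeModel D) D Bool :=
  inferInstanceAs (BoundedLatticeHomClass (BoundedLatticeHom D Bool) D Bool)

instance : PartialOrder (LatticeModel D) :=
  PartialOrder.lift (fun x => (x : D → Bool)) DFunLike.coe_injective

theorem LatticeModel.le_def {x y : LatticeModel D} : x ≤ y ↔ ∀ p : D, x p ≤ y p :=
  Iff.rfl

/-- The ultraproduct of models, computed pointwise in `2` by the canonical ultraproduct. -/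
def LatticeModel.ultraproduct {S : Type w} (f : S → LatticeModel D) (μ : Ultrafilter S) :
    LatticeModel D :=
  BoundedLatticeHom.mk
    (LatticeHom.mk
      (SupHom.mk (fun p => canonicalPair (fun s => f s p) μ) (fun p q => by
        rw [Bool.eq_iff_iff]
        change _ ↔ (canonicalPair _ μ || canonicalPair _ μ) = true
        simp only [Bool.or_eq_true, canonicalPair_bool_eq_true, ← Ultrafilter.union_mem_iff]
        refine iff_of_eq (congrArg (· ∈ μ) (Set.ext fun s => ?_))
        change f s (p ⊔ q) = true ↔ f s p = true ∨ f s q = true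
        rw [SupHomClass.map_sup]
        exact Bool.or_eq_true_iff))
      (fun p q => by
        rw [Bool.eq_iff_iff]
        change canonicalPair _ μ = true ↔ (canonicalPair _ μ && canonicalPair _ μ) = true
        simp only [Bool.and_eq_true, canonicalPair_bool_eq_true]
        rw [← Ultrafilter.mem_coe, ← Ultrafilter.mem_coe, ← Ultrafilter.mem_coe,
          ← Filter.inter_mem_iff]
        refine iff_of_eq (congrArg (· ∈ (μ : Filter S)) (Set.ext fun s => ?_))
        change f s (p ⊓ q) = true ↔ f s p = true ∧ f s q = true
        rw [InfHomClass.map_inf]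
        exact Bool.and_eq_true_iff))
    ((canonicalPair_bool_eq_true _ _).2
      (Filter.mem_of_superset Filter.univ_mem fun s _ => TopHomClass.map_top (f s)))
    (by
      change canonicalPair _ μ = false
      rw [← Bool.not_eq_true, canonicalPair_bool_eq_true]
      have h : {s | f s ⊥ = true} = ∅ := Set.eq_empty_of_forall_notMem fun s hs =>
        Bool.false_ne_true ((BotHomClass.map_bot (f s)).symm.trans hs)
      rw [h]
      exact Ultrafilter.empty_notMem)

theorem LatticeModel.ultraproduct_apply {S : Type w} (f : S → LatticeModel D) (μ : Ultrafilter S)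
    (p : D) : LatticeModel.ultraproduct f μ p = canonicalPair (fun s => f s p) μ := rfl

theorem LatticeModel.ext_true {x y : LatticeModel D} (h : ∀ p : D, x p = true ↔ y p = true) :
    x = y :=
  DFunLike.ext x y fun p => Bool.eq_iff_iff.2 (h p)

instance : Ultraposet (LatticeModel D) where
  pair := LatticeModel.ultraproduct
  pair_mono f g μ h := LatticeModel.le_def.2 fun p =>
    canonicalPair_mono (fun s => h s p) μ
  pair_pure f s := LatticeModel.ext_true fun p => by
    rw [LatticeModel.ultraproduct_apply, canonicalPair_bool_eq_true]
    exact Iff.rfl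
  pair_bind_le f μ ν := le_of_eq <| LatticeModel.ext_true fun p => by
    simp only [LatticeModel.ultraproduct_apply, canonicalPair_bool_eq_true]
    exact Iff.rfl
  pair_map f i ν _ := LatticeModel.ext_true fun p => by
    simp only [LatticeModel.ultraproduct_apply, canonicalPair_bool_eq_true]
    exact Iff.rfl

end Models

/-- Precomposition with a homomorphism of distributive lattices, as an ultrafunctor on models. -/
def LatticeModel.precomp {C D : Type u} [DistribLattice C] [BoundedOrder C] [DistribLattice D]
    [BoundedOrder D] (σ : BoundedLatticeHom C D) : UltraFunctor (LatticeModel D) (LatticeModel C) where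
  toFun := fun x : BoundedLatticeHom D Bool => x.comp σ
  monotone' _ _ h p := h (σ p)
  map_pair' _ _ := rfl

/-- The functor `Mod : DLᵒᵖ ⥤ UltPos`. -/
def modFunctor : BddDistLat.{u}ᵒᵖ ⥤ UltPos.{u} where
  obj D := ⟨LatticeModel D.unop⟩
  map σ := LatticeModel.precomp σ.unop.hom
  map_id _ := rfl
  map_comp _ _ := rfl

/-- The restriction of `Mod` to Boolean algebras. -/
def boolModFunctor : BoolAlg.{u}ᵒᵖ ⥤ UltPos.{u} :=
  (forget₂ BoolAlg.{u} BddDistLat.{u}).op ⋙ modFunctor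

/-- An isomorphism of categories: bijective on objects and on morphisms. -/
def IsCategoryIso {A : Type*} {B : Type*} [Category* A] [Category* B] (F : A ⥤ B) : Prop :=
  Function.Bijective F.obj ∧ ∀ X Y : A, Function.Bijective (F.map : (X ⟶ Y) → _)

end

noncomputable section

/-! ### Ultraposets with discrete order -/

section Ultrasets

variable {P : Type u} [PartialOrder P] [Ultraposet P]

/-! Over a discrete order lax associativity becomes an equality, so an ultraset is an algebra for
the ultrafilter monad, that is, a compact Hausdorff space (Manes). Its pairing is the limit along an
ultrafilter: limits are unique, so the topology determines the pairing, and continuous maps preserve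
it. Conversely, limits in a compact Hausdorff space form an ultraset; associativity there is
regularity. Since every subset is now a down-set and an up-set, zero-dimensionality means separation
of points by clopen sets, which for compact Hausdorff spaces is total disconnectedness.

On the lattice side everything rests on the prime ideal theorem, `LatticeModel.exists_of_disjoint`.
It supplies enough models to separate elements, so `Mod` is faithful, and it builds two distinct
comparable models from an element without complement. Fullness holds because every clopen set of a
discrete `Mod(D)` is the truth set of an element (`LatticeModel.exists_eq_of_ultraClosed`), a
compactness argument with ultraproducts. Essential surjectivity holds because evaluation identifies
a zero-dimensional ultraset with the models of its clopen algebra. -/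

theorem UltraClosed.pair_mem_iff {K : Set P} (hK : UltraClosed P K) (hK' : UltraClosed P Kᶜ)
    {S : Type u} (f : S → P) (μ : Ultrafilter S) :
    Ultraposet.pair f μ ∈ K ↔ f ⁻¹' K ∈ μ := by
  refine ⟨fun h => ?_, hK S f μ⟩
  by_contra hc
  exact hK' S f μ (Ultrafilter.compl_mem_iff_notMem.2 hc) h

theorem isClopen_ultraTopology_iff (K : Set P) :
    @IsClopen P (ultraTopology P) K ↔ UltraClosed P K ∧ UltraClosed P Kᶜ := by
  let _ := ultraTopology P
  rw [← isClosed_ultraTopology_iff, ← isClosed_ultraTopology_iff, isClosed_compl_iff]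
  rfl

theorem Ultraposet.tendsto_pair {S : Type u} (f : S → P) (μ : Ultrafilter S) :
    Tendsto f μ (@nhds _ (ultraTopology P) (pair f μ)) := by
  let _ := ultraTopology P
  refine tendsto_nhds.2 fun U hU hf => ?_
  by_contra hc
  exact (isClosed_ultraTopology_iff P Uᶜ).1 hU.isClosed_compl S f μ
    (Ultrafilter.compl_mem_iff_notMem.2 hc) hf

theorem DiscreteOrder.pair_bind (hP : DiscreteOrder P) {S T : Type u} (f : S → P)
    (μ : T → Ultrafilter S) (ν : Ultrafilter T) :
    Ultraposet.pair f (ν.bind μ) = Ultraposet.pair (fun t => Ultraposet.pair f (μ t)) ν :=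
  hP _ _ (Ultraposet.pair_bind_le f μ ν)

/-- A pushforward is a `bind` along principal ultrafilters, so strict associativity and unity extend
locality from injective maps to all maps. -/
theorem DiscreteOrder.pair_map (hP : DiscreteOrder P) {S W : Type u} (f : S → P) (i : W → S)
    (ν : Ultrafilter W) : Ultraposet.pair f (ν.map i) = Ultraposet.pair (f ∘ i) ν := by
  have h : ν.map i = ν.bind (fun w => pure (i w)) := Ultrafilter.ext fun _ => Iff.rfl
  rw [h, hP.pair_bind]
  simp only [Ultraposet.pair_pure]
  rfl

/-- An ultraposet with discrete order is an algebra for the ultrafilter monad. -/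
def DiscreteOrder.toCompactum (hP : DiscreteOrder P) : Compactum.{u} where
  A := P
  a := ↾(fun F : Ultrafilter P => Ultraposet.pair id F)
  unit := by
    ext x
    exact Ultraposet.pair_pure (P := P) id x
  assoc := by
    ext F
    change Ultrafilter (Ultrafilter P) at F
    exact (hP.pair_bind id id F).trans
      (hP.pair_map id (fun G : Ultrafilter P => Ultraposet.pair id G) F).symm

/-- Pushing `μ` forward along `f` reduces the closure condition to the family `id`, where it is
closure under the structure map of the algebra. -/
theorem DiscreteOrder.ultraTopology_eq (hP : DiscreteOrder P) :
    ultraTopology P = (inferInstance : TopologicalSpace hP.toCompactum) := by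
  refine TopologicalSpace.ext_iff_isClosed.2 fun K => ?_
  rw [isClosed_ultraTopology_iff]
  refine Iff.trans ?_ (Compactum.isClosed_iff (X := hP.toCompactum) K).symm
  refine ⟨fun h F hF => h P id F hF, fun h S f μ hf => ?_⟩
  have := h (μ.map f) hf
  rwa [show hP.toCompactum.str (μ.map f) = Ultraposet.pair f μ from hP.pair_map id f μ] at this

theorem DiscreteOrder.compactSpace (hP : DiscreteOrder P) : @CompactSpace P (ultraTopology P) := by
  rw [hP.ultraTopology_eq]
  exact inferInstanceAs (CompactSpace hP.toCompactum)

theorem DiscreteOrder.t2Space (hP : DiscreteOrder P) : @T2Space P (ultraTopology P) := by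
  rw [hP.ultraTopology_eq]
  exact inferInstanceAs (T2Space hP.toCompactum)

theorem DiscreteOrder.pair_eq_iff (hP : DiscreteOrder P) {S : Type u} (f : S → P)
    (μ : Ultrafilter S) (x : P) :
    Ultraposet.pair f μ = x ↔ Tendsto f μ (@nhds _ (ultraTopology P) x) := by
  let _ := ultraTopology P
  have := hP.t2Space
  exact ⟨fun h => h ▸ Ultraposet.tendsto_pair f μ,
    tendsto_nhds_unique (Ultraposet.tendsto_pair f μ)⟩

/-- The monotonicity conditions are void for a discrete order, which leaves total separatedness;
this agrees with total disconnectedness for compact Hausdorff spaces. -/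
theorem DiscreteOrder.zeroDimensional_iff_totallyDisconnected (hP : DiscreteOrder P) :
    ZeroDimensionalUltraposet P ↔ @TotallyDisconnectedSpace P (ultraTopology P) := by
  let _ := ultraTopology P
  have := hP.t2Space
  have := hP.compactSpace
  rw [loc_compact_t2_tot_disc_iff_tot_sep, totallySeparatedSpace_iff_exists_isClopen]
  constructor
  · intro h x y hxy
    obtain ⟨K, h1, -, h2, -, hx, hy⟩ := h x y (mt (hP x y) hxy)
    exact ⟨Kᶜ, ((isClopen_ultraTopology_iff K).2 ⟨h1, h2⟩).compl, hx, fun h => h hy⟩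
  · intro h x y hxy
    obtain ⟨U, hU, hx, hy⟩ := h (fun h : x = y => hxy h.le)
    obtain ⟨h1, h2⟩ := (isClopen_ultraTopology_iff _).1 hU.compl
    exact ⟨Uᶜ, h1, fun a b hab ha => hP b a hab ▸ ha, h2, fun a b hab ha => hP a b hab ▸ ha,
      fun h => h hx, hy⟩

theorem DiscreteOrder.zeroDimensional_iff_basis (hP : DiscreteOrder P) :
    ZeroDimensionalUltraposet P ↔
      @TopologicalSpace.IsTopologicalBasis P (ultraTopology P)
        {U | @IsClopen P (ultraTopology P) U} := by
  let _ := ultraTopology P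
  have := hP.t2Space
  have := hP.compactSpace
  rw [hP.zeroDimensional_iff_totallyDisconnected]
  refine ⟨fun _ => isTopologicalBasis_isClopen, fun h => ?_⟩
  have := totallySeparatedSpace_of_t0_of_basis_clopen h
  infer_instance

/-- Continuous maps of ultrasets are ultrafunctors. -/
def DiscreteOrder.ultraFunctorOfContinuous {Q : Type u} [PartialOrder Q] [Ultraposet Q]
    (hP : DiscreteOrder P) (hQ : DiscreteOrder Q) (g : P → Q)
    (hg : @Continuous _ _ (ultraTopology P) (ultraTopology Q) g) : UltraFunctor P Q where
  toFun := g
  monotone' x y h := (congrArg g (hP x y h)).le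
  map_pair' f μ := by
    let _ := ultraTopology P
    let _ := ultraTopology Q
    exact ((hQ.pair_eq_iff _ _ _).2
      ((hg.tendsto (Ultraposet.pair f μ)).comp (Ultraposet.tendsto_pair f μ))).symm

end Ultrasets

theorem UltPos.ext_of_ultraTopology_eq {X Y : UltPos.{u}} (hX : DiscreteOrder X)
    (hY : DiscreteOrder Y) (h : closedSetsFunctor.obj X = closedSetsFunctor.obj Y) : X = Y := by
  obtain @⟨P, o, s⟩ := X
  obtain @⟨Q, o', s'⟩ := Y
  obtain ⟨hPQ, htop⟩ := TopCat.of.inj h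
  cases hPQ
  have ho : o = o' := PartialOrder.ext fun x y =>
    ⟨fun h => (hX x y h) ▸ o'.le_refl x, fun h => (hY x y h) ▸ o.le_refl x⟩
  cases ho
  replace htop := eq_of_heq htop
  -- Both pairings are limits in the same Hausdorff topology.
  have hpair : @Ultraposet.pair P o s = @Ultraposet.pair P o s' := by
    funext S f μ
    refine (@DiscreteOrder.pair_eq_iff P o s hX S f μ _).2 ?_
    have := @Ultraposet.tendsto_pair P o s' S f μ
    rwa [← show @ultraTopology P o s = @ultraTopology P o s' from htop] at this
  have hs : s = s' := by
    cases s
    cases s'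
    congr
  rw [hs]

/-! ### Compact Hausdorff spaces as ultrasets -/

section OfSpace

variable (X : Type u) [TopologicalSpace X]

/-- A type with the discrete order. -/
@[reducible]
def discretePartialOrder (X : Type u) : PartialOrder X where
  le := Eq
  le_refl _ := rfl
  le_trans _ _ _ := Eq.trans
  le_antisymm _ _ h _ := h

variable [CompactSpace X] [T2Space X]

theorem lim_map_eq_of_tendsto {S : Type u} {f : S → X} {μ : Ultrafilter S} {x : X}
    (h : Tendsto f μ (𝓝 x)) : (μ.map f).lim = x :=
  Ultrafilter.lim_eq_iff_le_nhds.2 h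

omit [T2Space X] in
theorem tendsto_lim_map {S : Type u} (f : S → X) (μ : Ultrafilter S) :
    Tendsto f μ (𝓝 (μ.map f).lim) :=
  (μ.map f).le_nhds_lim

/-- The ultrastructure of a compact Hausdorff space, given by limits of ultrafilters. -/
@[reducible]
def ultraposetOfCompactT2 : @Ultraposet X (discretePartialOrder X) :=
  letI := discretePartialOrder X
  { pair := fun f μ => (μ.map f).lim
    pair_mono := fun f g μ h => by
      obtain rfl : f = g := funext h
      rfl
    pair_pure := fun f s => lim_map_eq_of_tendsto X (tendsto_pure_nhds f s)
    pair_bind_le := fun f μ ν => by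
      -- By regularity, closed neighbourhoods `C` of the limit suffice. For `ν`-almost all `t` the
      -- limit of `f` along `μ t` lies in the interior of `C`, which forces `f ⁻¹' C ∈ μ t`.
      refine lim_map_eq_of_tendsto X
        ((closed_nhds_basis _).tendsto_right_iff.2 fun C hC => ?_)
      have h := (tendsto_lim_map X (fun t => ((μ t).map f).lim) ν).eventually_mem
        (interior_mem_nhds.2 hC.1)
      change {t | f ⁻¹' C ∈ μ t} ∈ ν
      filter_upwards [h] with t ht
      exact mem_of_superset ((tendsto_lim_map X f (μ t)) (isOpen_interior.mem_nhds ht))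
        (Set.preimage_mono interior_subset)
    pair_map := fun _ _ _ _ => rfl }

theorem ultraTopology_ofCompactT2 :
    @ultraTopology X (discretePartialOrder X) (ultraposetOfCompactT2 X) = ‹TopologicalSpace X› := by
  refine TopologicalSpace.ext_iff_isClosed.2 fun K => ?_
  let _ := discretePartialOrder X
  let _ := ultraposetOfCompactT2 X
  rw [isClosed_ultraTopology_iff, isClosed_iff_ultrafilter]
  constructor
  · intro h x F hF hK
    have hx : (F.map id).lim = x := lim_map_eq_of_tendsto X hF
    exact hx ▸ h X id F hK
  · exact fun h S f μ hf => h _ (μ.map f) (tendsto_lim_map X f μ) hf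

/-- The ultraset of a compact Hausdorff space. -/
def UltPos.ofCompactT2 : UltPos.{u} :=
  @UltPos.mk X (discretePartialOrder X) (ultraposetOfCompactT2 X)

theorem UltPos.discreteOrder_ofCompactT2 : DiscreteOrder (UltPos.ofCompactT2 X) :=
  fun _ _ h => h

theorem closedSetsFunctor_ofCompactT2 :
    closedSetsFunctor.obj (UltPos.ofCompactT2 X) = TopCat.of X := by
  change @TopCat.of X (@ultraTopology X (discretePartialOrder X) (ultraposetOfCompactT2 X)) = _
  rw [ultraTopology_ofCompactT2]

end OfSpace

/-! ### Isomorphisms with categories of compact Hausdorff spaces -/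

section CompHausLike

variable {Q : ObjectProperty UltPos.{u}} {P : TopCat.{u} → Prop}

/-- The functor from a category of ultrasets to the corresponding category of compact
Hausdorff spaces. -/
def ultrasetsToCompHausLike
    (hQ : ∀ X, Q X ↔ DiscreteOrder X ∧ P (closedSetsFunctor.obj X)) :
    Q.FullSubcategory ⥤ CompHausLike.{u} P where
  obj X :=
    { toTop := closedSetsFunctor.obj X.obj
      is_compact := ((hQ X.obj).1 X.property).1.compactSpace
      is_hausdorff := ((hQ X.obj).1 X.property).1.t2Space
      prop := ((hQ X.obj).1 X.property).2 }
  map f := InducedCategory.homMk (closedSetsFunctor.map f.hom)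

/-- The predicate `P` lets one argument serve both compact Hausdorff spaces (`P` trivial) and Stone
spaces (`P` total disconnectedness). -/
theorem isCategoryIso_ultrasetsToCompHausLike
    (hQ : ∀ X, Q X ↔ DiscreteOrder X ∧ P (closedSetsFunctor.obj X)) :
    IsCategoryIso (ultrasetsToCompHausLike hQ) := by
  refine ⟨⟨fun X Y h => ?_, fun Y => ?_⟩, fun X Y => ⟨fun f g h => ?_, fun g => ?_⟩⟩
  · exact ObjectProperty.FullSubcategory.ext (UltPos.ext_of_ultraTopology_eq
      ((hQ _).1 X.property).1 ((hQ _).1 Y.property).1 (congrArg CompHausLike.toTop h))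
  · obtain ⟨T, hT⟩ := Y
    have e : closedSetsFunctor.obj (UltPos.ofCompactT2 T) = T := closedSetsFunctor_ofCompactT2 T
    refine ⟨⟨UltPos.ofCompactT2 T,
      (hQ _).2 ⟨UltPos.discreteOrder_ofCompactT2 T, e.symm ▸ hT⟩⟩, ?_⟩
    simp only [ultrasetsToCompHausLike]
    congr 1
  · refine ObjectProperty.hom_ext _ (UltraFunctor.ext (funext fun x => ?_))
    exact congrArg (fun k : (ultrasetsToCompHausLike hQ).obj X ⟶ (ultrasetsToCompHausLike hQ).obj Y =>
      k.hom x) h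
  · refine ⟨ObjectProperty.homMk (DiscreteOrder.ultraFunctorOfContinuous
      ((hQ _).1 X.property).1 ((hQ _).1 Y.property).1 g.hom g.hom.hom.continuous), rfl⟩

theorem IsCategoryIso.isEquivalence {A : Type*} {B : Type*} [Category* A] [Category* B]
    {F : A ⥤ B} (hF : IsCategoryIso F) : F.IsEquivalence where
  faithful := ⟨fun {X Y} => (hF.2 X Y).1⟩
  full := ⟨fun {X Y} => (hF.2 X Y).2⟩
  essSurj := ⟨fun Y => (hF.1.2 Y).elim fun X h => ⟨X, ⟨eqToIso h⟩⟩⟩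

end CompHausLike

/-! ### Models of distributive lattices and Boolean algebras -/

section Models

variable {D : Type u} [DistribLattice D] [BoundedOrder D]

open Order

/-- The prime ideal theorem for distributive lattices, in terms of models. -/
theorem LatticeModel.exists_of_disjoint (F : PFilter D) (I : Ideal D)
    (h : Disjoint (F : Set D) I) :
    ∃ x : LatticeModel D, (∀ d ∈ F, x d = true) ∧ ∀ d ∈ I, x d = false := by
  classical
  obtain ⟨J, hJ, hIJ, hFJ⟩ := DistribLattice.prime_ideal_of_disjoint_filter_ideal h
  have hJ' : ∀ {a b : D}, a ⊓ b ∈ J → a ∈ J ∨ b ∈ J := hJ.mem_or_mem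
  let x : BoundedLatticeHom D Bool :=
    { toFun := fun d => decide (d ∉ J)
      map_sup' := fun a b => by
        rw [Bool.eq_iff_iff]
        change _ ↔ (_ || _) = true
        simp only [Bool.or_eq_true, decide_eq_true_iff, Ideal.sup_mem_iff]
        tauto
      map_inf' := fun a b => by
        rw [Bool.eq_iff_iff]
        change _ ↔ (_ && _) = true
        simp only [Bool.and_eq_true, decide_eq_true_iff, ← not_or]
        exact not_congr ⟨hJ', fun h => h.elim (J.lower inf_le_left) (J.lower inf_le_right)⟩
      map_top' := decide_eq_true hJ.top_notMem
      map_bot' := decide_eq_false (not_not.2 J.bot_mem) }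
  exact ⟨x, fun d hd => decide_eq_true (Set.disjoint_left.1 hFJ hd),
    fun d hd => decide_eq_false (not_not.2 (hIJ hd))⟩

/-- Otherwise the principal filter of `a` misses the principal ideal of `b`, and some model
separates them. -/
theorem LatticeModel.le_of_forall {a b : D} (h : ∀ x : LatticeModel D, x a = true → x b = true) :
    a ≤ b := by
  by_contra hab
  obtain ⟨x, h1, h2⟩ := LatticeModel.exists_of_disjoint (PFilter.principal a) (Ideal.principal b)
    (Set.disjoint_left.2 fun d hd hd' => hab (le_trans (PFilter.mem_principal.1 hd) hd'))
  have := h x (h1 a (PFilter.mem_principal.2 le_rfl))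
  rw [h2 b (Ideal.mem_principal.2 le_rfl)] at this
  exact Bool.false_ne_true this

theorem LatticeModel.eq_of_forall {a b : D} (h : ∀ x : LatticeModel D, x a = x b) : a = b :=
  le_antisymm (le_of_forall fun x hx => h x ▸ hx) (le_of_forall fun x hx => (h x).symm ▸ hx)

theorem LatticeModel.map_sup_eq_true (x : LatticeModel D) {a b : D} :
    x (a ⊔ b) = true ↔ x a = true ∨ x b = true := by
  rw [SupHomClass.map_sup]
  exact Bool.or_eq_true_iff

theorem LatticeModel.map_inf_eq_true (x : LatticeModel D) {a b : D} :
    x (a ⊓ b) = true ↔ x a = true ∧ x b = true := by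
  rw [InfHomClass.map_inf]
  exact Bool.and_eq_true_iff

theorem LatticeModel.map_top_eq_true (x : LatticeModel D) : x ⊤ = true :=
  TopHomClass.map_top x

theorem LatticeModel.map_bot_ne_true (x : LatticeModel D) : x ⊥ ≠ true := by
  rw [show x ⊥ = false from BotHomClass.map_bot x]
  exact Bool.false_ne_true

theorem LatticeModel.le_iff {x y : LatticeModel D} : x ≤ y ↔ ∀ d, x d = true → y d = true :=
  LatticeModel.le_def.trans (forall_congr' fun _ => Bool.le_iff_imp)

theorem LatticeModel.map_mono_eq_true (x : LatticeModel D) {a b : D} (h : a ≤ b)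
    (ha : x a = true) : x b = true := by
  rw [← inf_eq_left.2 h] at ha
  exact (x.map_inf_eq_true.1 ha).2

theorem LatticeModel.discreteOrder_of_complemented [ComplementedLattice D] :
    DiscreteOrder (LatticeModel D) := by
  intro x y h
  refine le_antisymm h (LatticeModel.le_iff.2 fun d hd => ?_)
  obtain ⟨c, hc⟩ := exists_isCompl d
  by_contra hx
  have h1 := x.map_top_eq_true
  rw [← hc.sup_eq_top, map_sup_eq_true] at h1
  have h2 := y.map_inf_eq_true.2 ⟨hd, le_iff.1 h c (h1.resolve_left hx)⟩
  rw [hc.inf_eq_bot] at h2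
  exact y.map_bot_ne_true h2

/-- If `a` has no complement, there are models `x ≤ y` with `x a = false` and `y a = true`. -/
theorem complementedLattice_of_discreteOrder (h : DiscreteOrder (LatticeModel D)) :
    ComplementedLattice D := by
  refine ⟨fun a => ?_⟩
  by_contra hc
  -- The ideal generated by `a` and the elements disjoint from it; it contains `⊤` only if `a` has a
  -- complement.
  let I : Ideal D := IsIdeal.toIdeal (I := {z | ∃ b, a ⊓ b = ⊥ ∧ z ≤ a ⊔ b})
    ⟨fun z w hwz ⟨b, hb, hz⟩ => ⟨b, hb, hwz.trans hz⟩, ⟨⊥, ⊥, inf_bot_eq a, bot_le⟩,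
      fun z ⟨b, hb, hz⟩ w ⟨b', hb', hw⟩ => ⟨z ⊔ w, ⟨b ⊔ b', by rw [inf_sup_left, hb, hb', sup_bot_eq],
        sup_le (hz.trans (sup_le_sup_left le_sup_left _))
          (hw.trans (sup_le_sup_left le_sup_right _))⟩, le_sup_left, le_sup_right⟩⟩
  obtain ⟨x, -, hx⟩ := LatticeModel.exists_of_disjoint (PFilter.principal ⊤) I
    (Set.disjoint_left.2 fun d hd ⟨b, hb, hdb⟩ => hc ⟨b, disjoint_iff.2 hb,
      codisjoint_iff.2 (top_le_iff.1 ((PFilter.mem_principal.1 hd).trans hdb))⟩)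
  -- The filter generated by `a` and the elements true in `x`; a model `y` of it lies above `x` and
  -- makes `a` true.
  let F : PFilter D := IsPFilter.toPFilter (F := {z | ∃ c, x c = true ∧ a ⊓ c ≤ z})
    (IsPFilter.of_def ⟨⊤, ⊤, x.map_top_eq_true, le_top⟩
      (fun z ⟨c, hc, hz⟩ w ⟨c', hc', hw⟩ => ⟨z ⊓ w, ⟨c ⊓ c', x.map_inf_eq_true.2 ⟨hc, hc'⟩,
        le_inf ((inf_le_inf_left _ inf_le_left).trans hz)
          ((inf_le_inf_left _ inf_le_right).trans hw)⟩, inf_le_left, inf_le_right⟩)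
      (fun hzw ⟨c, hc, hz⟩ => ⟨c, hc, hz.trans hzw⟩))
  obtain ⟨y, hy, -⟩ := LatticeModel.exists_of_disjoint F (Ideal.principal ⊥) <| by
    refine Set.disjoint_left.2 ?_
    rintro d ⟨c, hc, hd⟩ hd'
    -- If `a ⊓ c = ⊥`, then `c ≤ a ⊔ c` puts `c` in `I`, where `x` vanishes.
    have : x c = false := hx c ⟨c, le_bot_iff.1 (hd.trans (Ideal.mem_principal.1 hd')), le_sup_right⟩
    exact Bool.false_ne_true (this.symm.trans hc)
  have hxy : x = y := h x y (LatticeModel.le_iff.2 fun d hd => hy d ⟨d, hd, inf_le_right⟩)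
  have h1 : x a = false := hx a ⟨⊥, inf_bot_eq a, le_sup_left⟩
  have h2 : y a = true := hy a ⟨⊤, x.map_top_eq_true, inf_le_left⟩
  rw [hxy, h2] at h1
  exact Bool.false_ne_true h1.symm

theorem LatticeModel.pair_eq_true {S : Type u} (f : S → LatticeModel D) (μ : Ultrafilter S)
    (d : D) : (Ultraposet.pair f μ : LatticeModel D) d = true ↔ {s | f s d = true} ∈ μ :=
  canonicalPair_bool_eq_true (fun s => f s d) μ

theorem LatticeModel.ultraClosed_true (d : D) :
    UltraClosed (LatticeModel D) {x | x d = true} :=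
  fun _ f μ h => (pair_eq_true f μ d).2 h

theorem LatticeModel.ultraClosed_true_compl (d : D) :
    UltraClosed (LatticeModel D) {x | x d = true}ᶜ :=
  fun _ f μ h h' => Ultrafilter.compl_mem_iff_notMem.1 h ((pair_eq_true f μ d).1 h')

theorem LatticeModel.zeroDimensional (hD : DiscreteOrder (LatticeModel D)) :
    ZeroDimensionalUltraposet (LatticeModel D) := by
  intro p q hpq
  obtain ⟨d, hp, hq⟩ : ∃ d, p d = true ∧ ¬ q d = true := by
    by_contra! hc
    exact hpq (LatticeModel.le_iff.2 hc)
  exact ⟨{x | x d = true}ᶜ, ultraClosed_true_compl d, fun x y h hx => hD y x h ▸ hx,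
    (compl_compl {x : LatticeModel D | x d = true}).symm ▸ ultraClosed_true d,
    fun x y h hx => hD x y h ▸ hx, fun h => h hp, hq⟩

/-- Every clopen set of models is the set of models of an element. -/
theorem LatticeModel.exists_eq_of_ultraClosed (hD : DiscreteOrder (LatticeModel D))
    {K : Set (LatticeModel D)} (hK : UltraClosed _ K) (hK' : UltraClosed _ Kᶜ) :
    ∃ d : D, ∀ x, x d = true ↔ x ∈ K := by
  -- Truth sets form a neighbourhood base. Otherwise each `d` true in `x` holds in some `y d ∉ K`;
  -- the ultraproduct along ever smaller `d` lies above `x`, hence equals `x`, yet lies in the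
  -- closed set `Kᶜ`.
  have h1 : ∀ x ∈ K, ∃ d, x d = true ∧ ∀ y : LatticeModel D, y d = true → y ∈ K := by
    intro x hx
    by_contra! hc
    choose y hy hyK using fun d : {d // x d = true} => hc d.1 d.2
    have : Nonempty {d // x d = true} := ⟨⟨⊤, x.map_top_eq_true⟩⟩
    have : IsCodirectedOrder {d // x d = true} := ⟨fun a b =>
      ⟨⟨a.1 ⊓ b.1, x.map_inf_eq_true.2 ⟨a.2, b.2⟩⟩, inf_le_left, inf_le_right⟩⟩
    let μ : Ultrafilter {d // x d = true} := Ultrafilter.of atBot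
    have hle : x ≤ Ultraposet.pair y μ := LatticeModel.le_iff.2 fun d hd =>
      (pair_eq_true y μ d).2 (mem_of_superset (Ultrafilter.of_le atBot (Iic_mem_atBot ⟨d, hd⟩))
        fun e he => (y e).map_mono_eq_true he (hy e))
    exact hK' _ y μ (Filter.mem_of_superset Filter.univ_mem fun d _ => hyK d) (hD _ _ hle ▸ hx)
  by_contra! hc
  -- If no single truth set equals `K`, each one contained in `K` misses a point of `K`. An
  -- ultraproduct of such points along ever larger `d` stays in `K` but escapes every one of these
  -- truth sets, against `h1`.
  have h2 : ∀ d : {d : D // ∀ y : LatticeModel D, y d = true → y ∈ K},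
      ∃ y ∈ K, ¬ y d.1 = true := by
    intro d
    by_contra! hd
    obtain ⟨x, hx⟩ := hc d.1
    rcases hx with hx | hx
    · exact hx.2 (d.2 x hx.1)
    · exact hx.1 (hd x hx.2)
  choose y hyK hy using h2
  let I := {d : D // ∀ y : LatticeModel D, y d = true → y ∈ K}
  have : Nonempty I := ⟨⟨⊥, fun y h => (y.map_bot_ne_true h).elim⟩⟩
  have : IsDirectedOrder I := ⟨fun a b =>
    ⟨⟨a.1 ⊔ b.1, fun y h => (y.map_sup_eq_true.1 h).elim (a.2 y) (b.2 y)⟩,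
      le_sup_left, le_sup_right⟩⟩
  let μ : Ultrafilter I := Ultrafilter.of atTop
  have hmem : Ultraposet.pair y μ ∈ K :=
    hK _ y μ (Filter.mem_of_superset Filter.univ_mem fun d _ => hyK d)
  obtain ⟨d, hd, hdK⟩ := h1 _ hmem
  have h3 := (pair_eq_true y μ d).1 hd
  have h4 : Set.Ici (⟨d, hdK⟩ : I) ∈ μ := Ultrafilter.of_le atTop (Ici_mem_atTop _)
  obtain ⟨e, he, he'⟩ := Ultrafilter.nonempty_of_mem (Filter.inter_mem h3 h4)
  exact hy e ((y e).map_mono_eq_true he' he)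

theorem LatticeModel.precomp_apply {C : Type u} [DistribLattice C] [BoundedOrder C]
    (σ : BoundedLatticeHom C D) (x : LatticeModel D) (c : C) :
    (LatticeModel.precomp σ).toFun x c = x (σ c) := rfl

theorem LatticeModel.precomp_injective {C : Type u} [DistribLattice C] [BoundedOrder C] :
    Function.Injective (LatticeModel.precomp : BoundedLatticeHom C D → _) := fun σ τ h =>
  DFunLike.ext _ _ fun c => eq_of_forall fun x => by
    rw [← precomp_apply, h, precomp_apply]

/-- The preimage under `φ` of the truth set of `c` is clopen, hence the truth set of some `σ c`;
since models separate elements, `σ` is a homomorphism. -/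
theorem LatticeModel.precomp_surjective {C : Type u} [DistribLattice C] [BoundedOrder C]
    (hD : DiscreteOrder (LatticeModel D)) :
    Function.Surjective (LatticeModel.precomp : BoundedLatticeHom C D → _) := by
  intro φ
  have h : ∀ c : C, ∃ d : D, ∀ x, x d = φ.toFun x c := by
    intro c
    obtain ⟨d, hd⟩ := exists_eq_of_ultraClosed hD
      (K := φ.toFun ⁻¹' {y | y c = true})
      (fun S f μ h => by
        rw [Set.mem_preimage, φ.map_pair']
        exact ultraClosed_true c S _ μ h)
      (fun S f μ h => by
        rw [← Set.preimage_compl, Set.mem_preimage, φ.map_pair']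
        exact ultraClosed_true_compl c S _ μ h)
    exact ⟨d, fun x => Bool.eq_iff_iff.2 (hd x)⟩
  choose σ hσ using h
  refine ⟨⟨⟨⟨σ, fun a b => ?_⟩, fun a b => ?_⟩, ?_, ?_⟩, ?_⟩
  · exact eq_of_forall fun x => by simp only [hσ, SupHomClass.map_sup]
  · exact eq_of_forall fun x => by simp only [hσ, InfHomClass.map_inf]
  · exact eq_of_forall fun x => by simp only [hσ, TopHomClass.map_top]
  · exact eq_of_forall fun x => by simp only [hσ, BotHomClass.map_bot]
  · exact UltraFunctor.ext (funext fun x => DFunLike.ext _ _ fun c => hσ c x)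

end Models

/-! ### Clopen sets of a zero-dimensional ultraset -/

section Clopens

attribute [local instance] ultraTopology

variable (P : Type u) [PartialOrder P] [Ultraposet P]

/-- The clopen sets of an ultraposet. -/
abbrev UltraClopens : Type u := TopologicalSpace.Clopens P

variable {P}

open Classical in
/-- Evaluation of clopen sets at a point. -/
def clopensEval (x : P) : LatticeModel (UltraClopens P) :=
  show BoundedLatticeHom (TopologicalSpace.Clopens P) Bool from
  { toFun := fun U => decide (x ∈ U)
    map_sup' := fun U V => by
      rw [Bool.eq_iff_iff]
      change _ ↔ (_ || _) = true
      simp only [Bool.or_eq_true, decide_eq_true_iff]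
      exact Iff.rfl
    map_inf' := fun U V => by
      rw [Bool.eq_iff_iff]
      change _ ↔ (_ && _) = true
      simp only [Bool.and_eq_true, decide_eq_true_iff]
      exact Iff.rfl
    map_top' := decide_eq_true (Set.mem_univ x)
    map_bot' := decide_eq_false (Set.notMem_empty x) }

theorem clopensEval_eq_true (x : P) (U : UltraClopens P) :
    clopensEval x U = true ↔ x ∈ U.carrier :=
  @decide_eq_true_iff _ (Classical.propDecidable _)

theorem UltraClopens.ultraClosed (U : UltraClopens P) :
    UltraClosed P U.carrier ∧ UltraClosed P U.carrierᶜ :=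
  (isClopen_ultraTopology_iff _).1 U.isClopen'

/-- Evaluation of clopen sets, as an ultrafunctor. -/
def clopensEvalUltraFunctor (hP : DiscreteOrder P) :
    UltraFunctor P (LatticeModel (UltraClopens P)) where
  toFun := clopensEval
  monotone' x y h := (congrArg clopensEval (hP x y h)).le
  map_pair' f μ := LatticeModel.ext_true fun U => by
    rw [clopensEval_eq_true, LatticeModel.pair_eq_true,
      U.ultraClosed.1.pair_mem_iff U.ultraClosed.2]
    simp only [Function.comp_apply, clopensEval_eq_true]
    rfl

theorem clopensEval_injective (hP : DiscreteOrder P) (hP' : ZeroDimensionalUltraposet P) :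
    Function.Injective (clopensEval : P → _) := by
  intro x y h
  refine hP x y ?_
  by_contra hxy
  obtain ⟨K, h1, -, h2, -, hx, hy⟩ := hP' x y hxy
  let U : UltraClopens P :=
    ⟨K, (isClopen_ultraTopology_iff K).2 ⟨h1, h2⟩⟩
  exact hx ((clopensEval_eq_true x U).1 (h ▸ (clopensEval_eq_true y U).2 hy))

theorem clopensEval_surjective : Function.Surjective (clopensEval : P → _) := by
  intro m
  have hne : ∀ U : {U // m U = true}, ∃ x, x ∈ U.1.carrier := by
    rintro ⟨U, hU⟩
    by_contra! hc
    have : U = ⊥ := TopologicalSpace.Clopens.ext (Set.eq_empty_of_forall_notMem hc)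
    exact m.map_bot_ne_true (this ▸ hU)
  choose x hx using hne
  have : Nonempty {U // m U = true} := ⟨⟨⊤, m.map_top_eq_true⟩⟩
  have : IsCodirectedOrder {U // m U = true} := ⟨fun a b =>
    ⟨⟨a.1 ⊓ b.1, m.map_inf_eq_true.2 ⟨a.2, b.2⟩⟩, inf_le_left (a := a.1), inf_le_right (a := a.1)⟩⟩
  -- Compactness: an ultrafilter containing all tails `V ≤ U` makes the pairing of the chosen points
  -- lie in every `U` true in `m`. This gives one inequality, and models of the Boolean algebra of
  -- clopens are discretely ordered.
  let μ : Ultrafilter {U // m U = true} := Ultrafilter.of atBot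
  refine ⟨Ultraposet.pair x μ, (LatticeModel.discreteOrder_of_complemented _ _ ?_).symm⟩
  refine LatticeModel.le_iff.2 fun U hU => (clopensEval_eq_true _ U).2 (U.ultraClosed.1 _ x μ ?_)
  exact mem_of_superset (Ultrafilter.of_le atBot (Iic_mem_atBot ⟨U, hU⟩)) fun V hV => hV (hx V)

end Clopens

/-- A bijective ultrafunctor of ultrasets is an isomorphism. -/
def UltPos.isoOfBijective {X Y : UltPos.{u}} (hY : DiscreteOrder Y) (φ : UltraFunctor X Y)
    (hφ : Function.Bijective φ.toFun) : X ≅ Y where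
  hom := φ
  inv :=
    { toFun := (Equiv.ofBijective _ hφ).symm
      monotone' := fun x y h => (congrArg _ (hY x y h)).le
      map_pair' := fun f μ => by
        rw [Equiv.symm_apply_eq, Equiv.ofBijective_apply, φ.map_pair', ← Function.comp_assoc]
        congr 1
        exact funext fun s => ((Equiv.ofBijective _ hφ).apply_symm_apply (f s)).symm }
  hom_inv_id := UltraFunctor.ext (funext (Equiv.ofBijective _ hφ).symm_apply_apply)
  inv_hom_id := UltraFunctor.ext (funext (Equiv.ofBijective _ hφ).apply_symm_apply)

/-! ### The equivalence between Boolean algebras and zero-dimensional ultrasets -/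

theorem isZeroDimUltraset_boolModFunctor (B : BoolAlg.{u}ᵒᵖ) :
    isZeroDimUltraset (boolModFunctor.obj B) := by
  have h : DiscreteOrder (LatticeModel B.unop) := LatticeModel.discreteOrder_of_complemented
  exact ⟨h, LatticeModel.zeroDimensional h⟩

instance : boolModFunctor.{u}.Faithful where
  map_injective {B C} σ τ h := by
    refine Quiver.Hom.unop_inj (ConcreteCategory.hom_ext _ _ fun b => ?_)
    exact DFunLike.congr_fun (LatticeModel.precomp_injective
      (show LatticeModel.precomp σ.unop.hom = LatticeModel.precomp τ.unop.hom from h)) b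

instance : boolModFunctor.{u}.Full where
  map_surjective {B C} φ := by
    obtain ⟨σ, hσ⟩ := LatticeModel.precomp_surjective (C := C.unop) (D := B.unop)
      LatticeModel.discreteOrder_of_complemented φ
    exact ⟨(BoolAlg.ofHom σ).op, hσ⟩

instance : (isZeroDimUltraset.lift boolModFunctor isZeroDimUltraset_boolModFunctor.{u}).EssSurj where
  mem_essImage X := by
    refine ⟨Opposite.op (BoolAlg.of (UltraClopens X.obj)), ⟨ObjectProperty.isoMk _ ?_⟩⟩
    refine (UltPos.isoOfBijective ?_ (clopensEvalUltraFunctor X.property.1)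
      ⟨clopensEval_injective X.property.1 X.property.2, clopensEval_surjective⟩).symm
    exact (isZeroDimUltraset_boolModFunctor _).1

theorem isEquivalence_lift_boolModFunctor :
    (isZeroDimUltraset.lift boolModFunctor isZeroDimUltraset_boolModFunctor.{u}).IsEquivalence where

end

theorem mainTheorem8 :
    -- `Mod(D)` is discrete iff `D` is Boolean
    (∀ (D : Type u) [DistribLattice D] [BoundedOrder D],
      DiscreteOrder (LatticeModel D) ↔ ComplementedLattice D) ∧
    -- an ultraset is a compact Hausdorff space in which its pairing is the limit of ultrafilters
    (∀ X : UltSet.{u},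
      CompactSpace (closedSetsFunctor.obj X.obj) ∧ T2Space (closedSetsFunctor.obj X.obj) ∧
      ∀ (S : Type u) (f : S → X.obj) (μ : Ultrafilter S),
        Tendsto f μ (@nhds _ (ultraTopology X.obj) (Ultraposet.pair f μ))) ∧
    -- an ultraset is zero-dimensional iff this space is zero-dimensional, viz. a Stone space
    (∀ X : UltSet.{u},
      (ZeroDimensionalUltraposet X.obj ↔
        TopologicalSpace.IsTopologicalBasis {U : Set (closedSetsFunctor.obj X.obj) | IsClopen U}) ∧
      (ZeroDimensionalUltraposet X.obj ↔
        TotallyDisconnectedSpace (closedSetsFunctor.obj X.obj))) ∧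
    -- ultrasets are isomorphic to compact Hausdorff spaces, over topological spaces
    (∃ E : UltSet.{u} ⥤ CompHaus.{u},
      E ⋙ compHausToTop = isUltraset.ι ⋙ closedSetsFunctor ∧ IsCategoryIso E) ∧
    -- zero-dimensional ultrasets are isomorphic to Stone spaces, and `Mod` restricts to an
    -- equivalence from `Boolᵒᵖ` to them; the composite is one half of `Stone ≃ Boolᵒᵖ`
    (∃ hM : ∀ B : BoolAlg.{u}ᵒᵖ, isZeroDimUltraset (boolModFunctor.obj B),
      (isZeroDimUltraset.lift boolModFunctor hM).IsEquivalence ∧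
      ∃ F : ZeroDimUltSet.{u} ⥤ Profinite.{u},
        F ⋙ Profinite.toTopCat = isZeroDimUltraset.ι ⋙ closedSetsFunctor ∧ IsCategoryIso F ∧
        ∃ e : Profinite.{u} ≌ BoolAlg.{u}ᵒᵖ,
          e.inverse = isZeroDimUltraset.lift boolModFunctor hM ⋙ F) := by
  -- `CompHaus` is the case of the trivial predicate, whence the conjunct `True`.
  have hE : ∀ X : UltPos.{u}, isUltraset X ↔ DiscreteOrder X ∧ True := fun X =>
    (iff_of_eq (and_true _)).symm
  have hF : ∀ X : UltPos.{u}, isZeroDimUltraset X ↔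
      DiscreteOrder X ∧ TotallyDisconnectedSpace (closedSetsFunctor.obj X) := fun X =>
    and_congr_right fun h => h.zeroDimensional_iff_totallyDisconnected
  let P : TopCat.{u} → Prop := fun T => TotallyDisconnectedSpace T
  refine ⟨fun D _ _ => ⟨complementedLattice_of_discreteOrder,
      fun _ => LatticeModel.discreteOrder_of_complemented⟩,
    fun X => ⟨X.property.compactSpace, X.property.t2Space, fun S f μ =>
      Ultraposet.tendsto_pair f μ⟩,
    fun X => ⟨X.property.zeroDimensional_iff_basis,
      X.property.zeroDimensional_iff_totallyDisconnected⟩,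
    ⟨ultrasetsToCompHausLike hE, rfl, isCategoryIso_ultrasetsToCompHausLike hE⟩,
    isZeroDimUltraset_boolModFunctor, isEquivalence_lift_boolModFunctor,
    ultrasetsToCompHausLike (P := P) hF, rfl, isCategoryIso_ultrasetsToCompHausLike (P := P) hF, ?_⟩
  have := isEquivalence_lift_boolModFunctor.{u}
  have := (isCategoryIso_ultrasetsToCompHausLike (P := P) hF).isEquivalence
  exact ⟨(isZeroDimUltraset.lift boolModFunctor isZeroDimUltraset_boolModFunctor ⋙
    ultrasetsToCompHausLike (P := P) hF).asEquivalence.symm, rfl⟩
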